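/- Let $0<a<1$ and $0<b<1$ with $b\le 2a$, and let $$p_*(a,b,1)=\frac{4-4a+2b}{b}.$$ Then the exponent $p_*(a,b,1)$ in the Mockenhaupt–Mitsis–Bak–Seeger restriction theorem is optimal in dimension $d=1$, in the following sense. For every real $p_0<p_*(a,b,1)$ there exists a Borel probability measure $\mu$ on $\mathbb{R}$ such that (A) there is a constant $C>0$ with $\mu((x-r,x+r))\le C r^{a}$ for all $x\in\mathbb{R}$ and all $r>0$; (B) there is a constant $C>0$ with $|\mathcal F(\mu)(\xi)|\le C(1+|\xi|)^{-b/2}$ for all $\xi\in\mathbb{R}$, where $\mathcal F(\mu)(\xi)=\int e^{-2\pi i x\xi}\,d\mu(x)$; and there exists a real $p\ge p_0$ with $1\le p<\infty$ for which the restriction inequality fails: there is no constant $C>0$ such that $$\|\mathcal F(f\mu)\|_{L^p(\mathbb{R})}\le C\,\|f\|_{L^2(\mu)}\qquad\text{for all } f\in L^2(\mu),$$ where $\mathcal F(f\mu)(\xi)=\int e^{-2\pi i x\xi}f(x)\,d\mu(x)$ and $L^p(\mathbb{R})$ is taken with respect to Lebesgue measure. -/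

import Mathlib

open MeasureTheory

noncomputable section

/-- The exponent `p_*(a, b, d) = (4d - 4a + 2b) / b`. -/
def pStar (a b d : ℝ) : ℝ := (4 * d - 4 * a + 2 * b) / b

/-- The Fourier transform of the complex measure `f μ` on the real line,
`ξ ↦ ∫ exp (-2πi x ξ) f x dμ x`. -/
def fourierMul (μ : Measure ℝ) (f : ℝ → ℂ) (ξ : ℝ) : ℂ :=
  Fourier.fourierIntegral Real.fourierChar μ f ξ

/-- The explicit form of the Fourier transform of `f μ`. -/
theorem fourierMul_eq (μ : Measure ℝ) (f : ℝ → ℂ) (ξ : ℝ) :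
    fourierMul μ f ξ = ∫ x, Complex.exp (-(2 * Real.pi * Complex.I * x * ξ)) * f x ∂μ := by
  unfold fourierMul
  rw [Fourier.fourierIntegral_def]
  refine integral_congr_ae (Filter.Eventually.of_forall fun x => ?_)
  simp only [Circle.smul_def, Real.fourierChar_apply, smul_eq_mul]
  congr 2
  push_cast
  ring

/-- The Fourier transform of the measure `μ` on the real line. -/
def fourierMeasure (μ : Measure ℝ) (ξ : ℝ) : ℂ := fourierMul μ (fun _ => 1) ξ

/-- Property (A): `μ (B(x, r)) ≤ C r ^ a` for all `x` and all `r > 0`. -/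
def BallCondition (μ : Measure ℝ) (a : ℝ) : Prop :=
  ∃ C : ℝ, 0 < C ∧ ∀ x r : ℝ, 0 < r → μ (Metric.ball x r) ≤ ENNReal.ofReal (C * r ^ a)

/-- Property (B): the Fourier transform of `μ` is at most `C (1 + |ξ|) ^ (-b / 2)` for all `ξ`. -/
def FourierDecay (μ : Measure ℝ) (b : ℝ) : Prop :=
  ∃ C : ℝ, 0 < C ∧ ∀ ξ : ℝ, ‖fourierMeasure μ ξ‖ ≤ C * (1 + |ξ|) ^ (-b / 2)

/-- Property (R) at the exponent `p`: the `L^p` norm (with respect to Lebesgue measure) of the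
Fourier transform of `f μ` is at most `C` times the `L^2(μ)` norm of `f`,
for all `f` in `L^2(μ)`. -/
def RestrictionInequality (μ : Measure ℝ) (p : ℝ) : Prop :=
  ∃ C : ℝ, 0 < C ∧ ∀ f : ℝ → ℂ, MemLp f 2 μ →
    eLpNorm (fourierMul μ f) (ENNReal.ofReal p) volume ≤ ENNReal.ofReal C * eLpNorm f 2 μ

end

noncomputable section

/-! ### Comb measures -/

/-! A comb of `q` teeth of width `δ` resonates at the multiples of `q`: its Fourier transform stays
large near about `1 / (δ q)` of them, those up to frequency of order `1 / δ`. Giving the comb weight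
`δ ^ (b/2)` makes the Fourier decay uniform in `δ`, and taking `q ≈ δ ^ (b/2 - a)` gives each tooth
weighted mass at most `δ ^ a`, which makes the ball condition uniform.

The measure is a normalized mixture of such combs at scales `δ n → 0`, with summable factors `t n`.
Testing the restriction inequality on the density of one component of weight `P` gives `P ^ (1/2) *
(δ q) ^ (-1/p) ≲ 1`. Here `δ q ≈ δ ^ τ` with `τ = 1 - a + b/2`, so the left side is of order `t ^
(1/2) * δ ^ (-η)`, where `η = τ/p - b/4` is positive exactly when `p < pStar a b 1`. With `δ = t ^
(1/η)` this is `t ^ (-1/2)`, which is unbounded. The two sides of the test are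
`le_eLpNorm_fourierMeasure_combMeasure` and `RestrictionInequality.eLpNorm_fourierMeasure_le`. -/

/-- The average, over `k < q`, of the uniform probability measures on the intervals
`(k / q, k / q + δ]`. -/
def combMeasure (q : ℕ) (δ : ℝ) : Measure ℝ :=
  ∑ k ∈ Finset.range q,
    ENNReal.ofReal ((q * δ)⁻¹) • volume.restrict (Set.Ioc (k / q : ℝ) (k / q + δ))

theorem combMeasure_apply (q : ℕ) (δ : ℝ) {s : Set ℝ} (hs : MeasurableSet s) :
    combMeasure q δ s = ∑ k ∈ Finset.range q,
      ENNReal.ofReal ((q * δ)⁻¹) * volume (s ∩ Set.Ioc (k / q : ℝ) (k / q + δ)) := by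
  simp [combMeasure, Measure.finsetSum_apply, Measure.restrict_apply hs]

theorem isProbabilityMeasure_combMeasure {q : ℕ} (hq : 0 < q) {δ : ℝ} (hδ : 0 < δ) :
    IsProbabilityMeasure (combMeasure q δ) := by
  have hq' : (0 : ℝ) < q := by exact_mod_cast hq
  refine ⟨?_⟩
  rw [combMeasure_apply _ _ MeasurableSet.univ]
  simp only [Set.univ_inter, Real.volume_Ioc, add_sub_cancel_left, Finset.sum_const,
    Finset.card_range, nsmul_eq_mul]
  rw [← ENNReal.ofReal_natCast, ← ENNReal.ofReal_mul (by positivity),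
    ← ENNReal.ofReal_mul (by positivity), ENNReal.ofReal_eq_one]
  field_simp

theorem integral_combMeasure (q : ℕ) {δ : ℝ} (hδ : 0 < δ) {f : ℝ → ℂ} (hf : Continuous f) :
    ∫ x, f x ∂combMeasure q δ =
      ∑ k ∈ Finset.range q, ((q * δ)⁻¹ : ℝ) • ∫ x in (k / q : ℝ)..(k / q + δ), f x := by
  rw [combMeasure, integral_finsetSum_measure]
  · refine Finset.sum_congr rfl fun k _ => ?_
    rw [integral_smul_measure, ENNReal.toReal_ofReal (by positivity),
      intervalIntegral.integral_of_le (by linarith)]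
  · intro k _
    exact ((hf.integrableOn_Icc).mono_set Set.Ioc_subset_Icc_self).smul_measure
      ENNReal.ofReal_ne_top

theorem card_natCast_mem_Icc_le (s : Finset ℕ) {α β : ℝ} (h : α ≤ β)
    (hs : ∀ k ∈ s, α ≤ k ∧ (k : ℝ) ≤ β) : (s.card : ℝ) ≤ β - α + 1 := by
  have h1 : s.card ≤ (Finset.Icc ⌈α⌉ ⌊β⌋).card := by
    refine Finset.card_le_card_of_injOn (fun k => (k : ℤ)) ?_ ?_
    · intro k hk
      obtain ⟨h1, h2⟩ := hs k hk
      simp only [Finset.coe_Icc, Set.mem_Icc]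
      exact ⟨Int.ceil_le.2 (by exact_mod_cast h1), Int.le_floor.2 (by exact_mod_cast h2)⟩
    · intro i _ j _ hij
      simpa using hij
  have h2 : ((Finset.Icc ⌈α⌉ ⌊β⌋).card : ℝ) ≤ β - α + 1 := by
    rw [Int.card_Icc]
    rcases le_or_gt (⌊β⌋ + 1 - ⌈α⌉) 0 with h0 | h0
    · rw [Int.toNat_of_nonpos h0]; push_cast; linarith
    · have : (((⌊β⌋ + 1 - ⌈α⌉).toNat : ℤ) : ℝ) = ((⌊β⌋ + 1 - ⌈α⌉ : ℤ) : ℝ) := by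
        rw [Int.toNat_of_nonneg h0.le]
      rw [Int.cast_natCast] at this
      rw [this]
      push_cast
      linarith [Int.floor_le β, Int.le_ceil α]
  exact (Nat.cast_le.2 h1).trans h2

/-- At most `q (2r + 2δ) + 1` teeth can meet the ball, and each overlaps it in length at most `min δ
(2r)`. -/
theorem combMeasure_ball_le {q : ℕ} (hq : 0 < q) {δ : ℝ} (hδ : 0 < δ) (x : ℝ) {r : ℝ}
    (hr : 0 < r) :
    combMeasure q δ (Metric.ball x r) ≤
      ENNReal.ofReal ((2 * r + 2 * δ + (q : ℝ)⁻¹) * min 1 (2 * r / δ)) := by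
  have hq' : (0 : ℝ) < q := by exact_mod_cast hq
  classical
  rw [combMeasure_apply _ _ measurableSet_ball, ← Finset.mul_sum]
  set s := (Finset.range q).filter fun k : ℕ =>
    q * (x - r - δ) ≤ k ∧ (k : ℝ) ≤ q * (x + r + δ) with hs
  have hsum : ∑ k ∈ Finset.range q,
      volume (Metric.ball x r ∩ Set.Ioc (k / q : ℝ) (k / q + δ)) ≤
      ∑ k ∈ s, ENNReal.ofReal (min δ (2 * r)) := by
    rw [hs, Finset.sum_filter]
    refine Finset.sum_le_sum fun k _ => ?_
    split_ifs with hk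
    · rw [ENNReal.ofReal_min]
      refine le_min ?_ ?_
      · refine (measure_mono Set.inter_subset_right).trans_eq ?_
        rw [Real.volume_Ioc, add_sub_cancel_left]
      · refine (measure_mono Set.inter_subset_left).trans_eq ?_
        rw [Real.volume_ball]
    · refine (measure_mono_null (t := ∅) ?_ measure_empty).le
      rintro y ⟨hy1, hy2⟩
      refine hk ?_
      rw [Real.ball_eq_Ioo] at hy1
      have e : q * (k / q : ℝ) = k := by field_simp
      constructor
      · rw [← e]; exact mul_le_mul_of_nonneg_left (by linarith [hy1.1, hy2.2]) hq'.le
      · rw [← e]; exact mul_le_mul_of_nonneg_left (by linarith [hy1.2, hy2.1]) hq'.le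
  have hcard : (s.card : ℝ) ≤ q * (x + r + δ) - q * (x - r - δ) + 1 := by
    refine card_natCast_mem_Icc_le s (mul_le_mul_of_nonneg_left (by linarith) hq'.le) ?_
    intro k hk
    exact (Finset.mem_filter.1 hk).2
  refine (mul_le_mul_right hsum _).trans ?_
  rw [Finset.sum_const, nsmul_eq_mul, ← ENNReal.ofReal_natCast,
    ← ENNReal.ofReal_mul (by positivity), ← ENNReal.ofReal_mul (by positivity)]
  refine ENNReal.ofReal_le_ofReal ?_
  have hm : min δ (2 * r) = δ * min 1 (2 * r / δ) := by
    rw [mul_min_of_nonneg _ _ hδ.le, mul_one, mul_div_cancel₀ _ hδ.ne']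
  have hm0 : 0 ≤ min 1 (2 * r / δ) := by positivity
  rw [hm]
  calc ((q : ℝ) * δ)⁻¹ * (s.card * (δ * min 1 (2 * r / δ)))
      = (q : ℝ)⁻¹ * s.card * min 1 (2 * r / δ) := by field_simp
    _ ≤ (q : ℝ)⁻¹ * (q * (x + r + δ) - q * (x - r - δ) + 1) * min 1 (2 * r / δ) := by gcongr
    _ = _ := by field_simp; ring

/-- Interpolates a trivial bound `1` with a bound `t`; used for both the ball condition and the
Fourier decay. -/
theorem min_one_le_rpow {t s : ℝ} (ht : 0 ≤ t) (hs0 : 0 ≤ s) (hs1 : s ≤ 1) :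
    min 1 t ≤ t ^ s := by
  rcases le_total t 1 with h | h
  · rw [min_eq_right h]
    exact Real.self_le_rpow_of_le_one ht h hs1
  · exact (min_le_left _ _).trans (Real.one_le_rpow h hs0)

/-- The weighted comb measure satisfies the ball condition, uniformly in the scale. -/
theorem mul_combMeasure_ball_le {q : ℕ} (hq : 0 < q) {δ w a : ℝ} (hδ : 0 < δ)
    (ha0 : 0 < a) (ha1 : a < 1) (hw0 : 0 ≤ w) (hw1 : w ≤ 1) (hwq : w / q ≤ δ ^ a)
    (x : ℝ) {r : ℝ} (hr : 0 < r) :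
    ENNReal.ofReal w * combMeasure q δ (Metric.ball x r) ≤ ENNReal.ofReal (8 * r ^ a) := by
  have hq' : (0 : ℝ) < q := by exact_mod_cast hq
  rcases le_total r 1 with h | h
  · refine (mul_le_mul_right (combMeasure_ball_le hq hδ x hr) _).trans ?_
    rw [← ENNReal.ofReal_mul hw0]
    refine ENNReal.ofReal_le_ofReal ?_
    have hra : r ≤ r ^ a := Real.self_le_rpow_of_le_one hr.le h ha1.le
    set m := min 1 (2 * r / δ) with hm
    have hm0 : 0 ≤ m := by positivity
    have hm1 : m ≤ 1 := min_le_left _ _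
    have hδm : δ * m ≤ 2 * r := by
      calc δ * m ≤ δ * (2 * r / δ) := by gcongr; exact min_le_right _ _
        _ = 2 * r := by field_simp
    have hqm : w / q * m ≤ 2 * r ^ a := by
      calc w / q * m ≤ δ ^ a * (2 * r / δ) ^ a := by
            gcongr
            exact min_one_le_rpow (by positivity) ha0.le ha1.le
        _ = 2 ^ a * r ^ a := by
            rw [← Real.mul_rpow hδ.le (by positivity), mul_div_cancel₀ _ hδ.ne',
              Real.mul_rpow (by norm_num) hr.le]
        _ ≤ 2 * r ^ a := by
            gcongr
            calc (2 : ℝ) ^ a ≤ 2 ^ (1 : ℝ) :=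
                  Real.rpow_le_rpow_of_exponent_le (by norm_num) ha1.le
              _ = 2 := Real.rpow_one 2
    -- The three terms come from the radius, the tooth width and the single extra tooth; only the
    -- last needs `w / q ≤ δ ^ a`.
    have e : w * ((2 * r + 2 * δ + (q : ℝ)⁻¹) * m) =
        2 * r * (w * m) + 2 * (w * (δ * m)) + w / q * m := by field_simp
    have h1 : w * m ≤ 1 := mul_le_one₀ hw1 hm0 hm1
    have h2 : w * (δ * m) ≤ δ * m := mul_le_of_le_one_left (by positivity) hw1
    have h3 : 2 * r * (w * m) ≤ 2 * r := mul_le_of_le_one_right (by positivity) h1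
    linarith
  · have := isProbabilityMeasure_combMeasure hq hδ
    calc ENNReal.ofReal w * combMeasure q δ (Metric.ball x r)
        ≤ 1 * 1 := by
          gcongr
          · exact ENNReal.ofReal_le_one.2 hw1
          · exact prob_le_one
      _ = ENNReal.ofReal 1 := by simp
      _ ≤ _ := ENNReal.ofReal_le_ofReal (by linarith [Real.one_le_rpow h ha0.le])

/-! ### Fourier transform of comb measures -/

theorem fourierMeasure_eq (μ : Measure ℝ) (ξ : ℝ) :
    fourierMeasure μ ξ = ∫ x : ℝ, Complex.exp (-(2 * Real.pi * ξ) * Complex.I * x) ∂μ := by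
  rw [fourierMeasure, fourierMul_eq]
  refine integral_congr_ae (Filter.Eventually.of_forall fun x => ?_)
  simp only [mul_one]
  congr 1
  ring

theorem norm_exp_character (ξ x : ℝ) :
    ‖Complex.exp (-(2 * Real.pi * ξ) * Complex.I * x)‖ = 1 := by
  have : (-(2 * Real.pi * ξ) * Complex.I * x : ℂ) =
      ((-(2 * Real.pi * ξ * x) : ℝ) : ℂ) * Complex.I := by
    push_cast; ring
  rw [this, Complex.norm_exp_ofReal_mul_I]

theorem norm_fourierMeasure_le_one (μ : Measure ℝ) [IsProbabilityMeasure μ] (ξ : ℝ) :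
    ‖fourierMeasure μ ξ‖ ≤ 1 := by
  rw [fourierMeasure_eq]
  refine (norm_integral_le_of_norm_le_const (C := 1)
    (Filter.Eventually.of_forall fun x => (norm_exp_character ξ x).le)).trans ?_
  simp

theorem norm_integral_character_le {ξ : ℝ} (hξ : ξ ≠ 0) (c d : ℝ) :
    ‖∫ x in c..d, Complex.exp (-(2 * Real.pi * ξ) * Complex.I * x)‖ ≤ |ξ|⁻¹ := by
  have hc : (-(2 * Real.pi * ξ) * Complex.I : ℂ) ≠ 0 := by
    simp [Real.pi_ne_zero, hξ]
  rw [integral_exp_mul_complex hc, norm_div]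
  have h1 : ‖(-(2 * Real.pi * ξ) * Complex.I : ℂ)‖ = 2 * Real.pi * |ξ| := by
    simp [abs_of_pos Real.pi_pos]
  have h2 : ‖Complex.exp (-(2 * Real.pi * ξ) * Complex.I * d) -
      Complex.exp (-(2 * Real.pi * ξ) * Complex.I * c)‖ ≤ 2 := by
    refine (norm_sub_le _ _).trans ?_
    rw [norm_exp_character, norm_exp_character]
    norm_num
  have hξ' : 0 < |ξ| := abs_pos.2 hξ
  rw [h1, div_le_iff₀ (by positivity)]
  calc _ ≤ (2 : ℝ) := h2
    _ ≤ 2 * Real.pi := by linarith [Real.pi_gt_three]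
    _ = _ := by field_simp

/-- Each tooth is integrated exactly; cancellation between teeth is not needed. -/
theorem norm_fourierMeasure_combMeasure_le {q : ℕ} (hq : 0 < q) {δ : ℝ} (hδ : 0 < δ) {ξ : ℝ}
    (hξ : ξ ≠ 0) : ‖fourierMeasure (combMeasure q δ) ξ‖ ≤ (δ * |ξ|)⁻¹ := by
  have hq' : (0 : ℝ) < q := by exact_mod_cast hq
  rw [fourierMeasure_eq, integral_combMeasure q hδ (by fun_prop)]
  refine (norm_sum_le_of_le (n := fun _ => (q * δ)⁻¹ * |ξ|⁻¹) _ ?_).trans_eq ?_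
  · intro k _
    rw [norm_smul, Real.norm_of_nonneg (by positivity)]
    gcongr
    exact norm_integral_character_le hξ _ _
  · rw [Finset.sum_const, Finset.card_range, nsmul_eq_mul]
    field_simp

/-- The weighted comb measure has Fourier decay, uniformly in the scale. -/
theorem rpow_mul_norm_fourierMeasure_combMeasure_le {q : ℕ} (hq : 0 < q) {δ s : ℝ} (hδ : 0 < δ)
    (hδ1 : δ ≤ 1) (hs0 : 0 ≤ s) (hs1 : s ≤ 1) (ξ : ℝ) :
    δ ^ s * ‖fourierMeasure (combMeasure q δ) ξ‖ ≤ 2 * (1 + |ξ|) ^ (-s) := by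
  have := isProbabilityMeasure_combMeasure hq hδ
  have h2 : (2 : ℝ) ^ s ≤ 2 :=
    (Real.rpow_le_rpow_of_exponent_le (by norm_num) hs1).trans_eq (Real.rpow_one 2)
  have hle := norm_fourierMeasure_le_one (combMeasure q δ) ξ
  rw [Real.rpow_neg (by positivity), ← div_eq_mul_inv, le_div_iff₀ (by positivity)]
  rcases le_total |ξ| 1 with h | h
  · calc δ ^ s * ‖fourierMeasure (combMeasure q δ) ξ‖ * (1 + |ξ|) ^ s
        ≤ 1 * 1 * 2 ^ s := by
          gcongr
          · exact Real.rpow_le_one hδ.le hδ1 hs0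
          · linarith
      _ ≤ 2 := by linarith
  · have hξ : ξ ≠ 0 := by rintro rfl; norm_num at h
    have h3 : ‖fourierMeasure (combMeasure q δ) ξ‖ ≤ (δ * |ξ|)⁻¹ ^ s :=
      (le_min hle (norm_fourierMeasure_combMeasure_le hq hδ hξ)).trans
        (min_one_le_rpow (by positivity) hs0 hs1)
    calc δ ^ s * ‖fourierMeasure (combMeasure q δ) ξ‖ * (1 + |ξ|) ^ s
        ≤ δ ^ s * (δ * |ξ|)⁻¹ ^ s * (2 * |ξ|) ^ s := by
          gcongr
          linarith
      _ = (δ * (δ * |ξ|)⁻¹ * (2 * |ξ|)) ^ s := by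
          rw [← Real.mul_rpow (by positivity) (by positivity),
            ← Real.mul_rpow (by positivity) (by positivity)]
      _ = 2 ^ s := by
          congr 1
          have : |ξ| ≠ 0 := by positivity
          field_simp
      _ ≤ 2 := h2

/-- On the `k`-th tooth, `ξ x` exceeds the integer `k m` by at most `1/16` from the offset of `ξ`
and `1/16` from the tooth width. The phase is then at most `2π/8 ≤ 1` modulo `2π`, where the cosine
is at least `1/2`, so all teeth add up. -/
theorem half_le_norm_fourierMeasure_combMeasure {q : ℕ} (hq : 0 < q) {δ : ℝ} (hδ : 0 < δ)
    (m : ℕ) {ξ : ℝ} (h1 : m * q ≤ ξ) (h2 : ξ ≤ m * q + 1 / 16) (h3 : δ * ξ ≤ 1 / 16) :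
    1 / 2 ≤ ‖fourierMeasure (combMeasure q δ) ξ‖ := by
  have hq' : (0 : ℝ) < q := by exact_mod_cast hq
  have hcos : ∀ k ∈ Finset.range q, ∀ x ∈ Set.Icc (k / q : ℝ) (k / q + δ),
      1 / 2 ≤ Real.cos (2 * Real.pi * ξ * x) := by
    intro k hk x hx
    have hkq : (k / q : ℝ) ≤ 1 := by
      rw [div_le_one hq']; exact_mod_cast (Finset.mem_range.1 hk).le
    set θ := ξ * x - (k * m : ℕ) with hθ
    have e : ξ * x - (k * m : ℕ) = (ξ - m * q) * (k / q) + ξ * (x - k / q) := by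
      push_cast; field_simp; ring
    have hm0 : (0 : ℝ) ≤ m * q := by positivity
    have hk0 : (0 : ℝ) ≤ k / q := by positivity
    have hθ0 : 0 ≤ θ := by
      rw [hθ, e]
      exact add_nonneg (mul_nonneg (by linarith) hk0)
        (mul_nonneg (by linarith) (by linarith [hx.1]))
    have hθ1 : θ ≤ 1 / 8 := by
      rw [hθ, e]
      have i1 : (ξ - m * q) * (k / q : ℝ) ≤ 1 / 16 * 1 :=
        mul_le_mul (by linarith) hkq hk0 (by norm_num)
      have i2 : ξ * (x - k / q : ℝ) ≤ ξ * δ :=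
        mul_le_mul_of_nonneg_left (by linarith [hx.2]) (by linarith)
      linarith
    have e2 : 2 * Real.pi * ξ * x = 2 * Real.pi * θ + (k * m : ℕ) * (2 * Real.pi) := by
      rw [hθ]; ring
    rw [e2, Real.cos_add_nat_mul_two_pi]
    have i3 : 2 * Real.pi * θ ≤ 1 := by
      have : 2 * Real.pi * θ ≤ 2 * 4 * (1 / 8) := by
        gcongr
        exact Real.pi_le_four
      linarith
    have i4 : 0 ≤ 2 * Real.pi * θ := by positivity
    have i5 : (2 * Real.pi * θ) ^ 2 ≤ 1 := pow_le_one₀ i4 i3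
    linarith [Real.one_sub_sq_div_two_le_cos (x := 2 * Real.pi * θ)]
  refine le_trans ?_ (Complex.re_le_norm _)
  rw [fourierMeasure_eq, integral_combMeasure q hδ (by fun_prop), Complex.re_sum]
  have hterm : ∀ k ∈ Finset.range q, (q : ℝ)⁻¹ * (1 / 2) ≤
      (((q * δ)⁻¹ : ℝ) • ∫ x in (k / q : ℝ)..(k / q + δ),
        Complex.exp (-(2 * Real.pi * ξ) * Complex.I * x)).re := by
    intro k hk
    have hre : (∫ x in (k / q : ℝ)..(k / q + δ),
        Complex.exp (-(2 * Real.pi * ξ) * Complex.I * x)).re =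
        ∫ x in (k / q : ℝ)..(k / q + δ), Real.cos (2 * Real.pi * ξ * x) := by
      have hint : IntervalIntegrable
          (fun x : ℝ => Complex.exp (-(2 * Real.pi * ξ) * Complex.I * x)) volume
          (k / q : ℝ) (k / q + δ) := Continuous.intervalIntegrable (by fun_prop) _ _
      have := Complex.reCLM.intervalIntegral_comp_comm hint
      simp only [Complex.reCLM_apply] at this
      rw [← this]
      congr 1
      ext x
      have : (-(2 * Real.pi * ξ) * Complex.I * x : ℂ) =
          ((-(2 * Real.pi * ξ * x) : ℝ) : ℂ) * Complex.I := by
        push_cast; ring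
      rw [this, Complex.exp_ofReal_mul_I_re, Real.cos_neg]
    rw [Complex.smul_re, hre, smul_eq_mul]
    have hlow : δ * (1 / 2) ≤
        ∫ x in (k / q : ℝ)..(k / q + δ), Real.cos (2 * Real.pi * ξ * x) := by
      have h : ∫ _ in (k / q : ℝ)..(k / q + δ), (1 / 2 : ℝ) ≤
          ∫ x in (k / q : ℝ)..(k / q + δ), Real.cos (2 * Real.pi * ξ * x) :=
        intervalIntegral.integral_mono_on (by linarith) (by simp)
          (Continuous.intervalIntegrable (by fun_prop) _ _) (hcos k hk)
      simpa using h
    calc (q : ℝ)⁻¹ * (1 / 2) = (q * δ)⁻¹ * (δ * (1 / 2)) := by field_simp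
      _ ≤ _ := by gcongr
  refine le_trans ?_ (Finset.sum_le_sum hterm)
  rw [Finset.sum_const, Finset.card_range, nsmul_eq_mul]
  exact le_of_eq (by field_simp)

/-- The transform is at least `1/2` on `K` disjoint windows of length `1/16`. Rounding `(16 δ q)⁻¹ ≥
1` down to `K` loses at most a factor `2`, hence `512 = 32 * 16`. -/
theorem le_eLpNorm_fourierMeasure_combMeasure {q : ℕ} (hq : 0 < q) {δ p : ℝ} (hδ : 0 < δ)
    (hp : 0 < p) (h : 16 * (δ * q) ≤ 1) :
    ENNReal.ofReal (1 / 2 * (512 * (δ * q))⁻¹ ^ (1 / p)) ≤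
      eLpNorm (fourierMeasure (combMeasure q δ)) (ENNReal.ofReal p) volume := by
  have hq' : (1 : ℝ) ≤ q := by exact_mod_cast hq
  set K := ⌊(16 * (δ * q))⁻¹⌋₊ with hK
  set I : ℕ → Set ℝ := fun m => Set.Icc (m * q : ℝ) (m * q + 1 / 16) with hI
  set E : Set ℝ := ⋃ m ∈ Finset.range K, I m with hE
  have hEm : MeasurableSet E := Finset.measurableSet_biUnion _ fun m _ => measurableSet_Icc
  have hone : 1 ≤ (16 * (δ * q))⁻¹ := (one_le_inv₀ (by positivity)).2 h
  have hKle : (K : ℝ) ≤ (16 * (δ * q))⁻¹ := Nat.floor_le (by positivity)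
  have hKge : (32 * (δ * q))⁻¹ ≤ K := by
    have h1 := Nat.lt_floor_add_one (16 * (δ * q))⁻¹
    have h2 : (1 : ℝ) ≤ K := by
      exact_mod_cast Nat.le_floor (by exact_mod_cast hone : ((1 : ℕ) : ℝ) ≤ _)
    have h3 : (32 * (δ * q))⁻¹ = (16 * (δ * q))⁻¹ / 2 := by field_simp; norm_num
    rw [h3]
    linarith
  have hdisj : Set.PairwiseDisjoint (↑(Finset.range K)) I := by
    have key : ∀ i j : ℕ, i < j → Disjoint (I i) (I j) := by
      intro i j hij
      rw [Set.disjoint_left]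
      rintro x ⟨_, hx⟩ ⟨hy, _⟩
      have : ((i : ℝ) + 1) * q ≤ j * q := by
        gcongr
        exact_mod_cast hij
      linarith
    intro i _ j _ hij
    rcases lt_or_gt_of_ne hij with h' | h'
    · exact key i j h'
    · exact (key j i h').symm
  have hvol : ENNReal.ofReal (512 * (δ * q))⁻¹ ≤ volume E := by
    rw [hE, measure_biUnion_finset hdisj fun m _ => measurableSet_Icc]
    simp only [hI, Real.volume_Icc, add_sub_cancel_left, Finset.sum_const, Finset.card_range,
      nsmul_eq_mul]
    rw [← ENNReal.ofReal_natCast, ← ENNReal.ofReal_mul (by positivity)]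
    refine ENNReal.ofReal_le_ofReal ?_
    have h3 : (512 * (δ * q))⁻¹ = (32 * (δ * q))⁻¹ * (1 / 16) := by field_simp; norm_num
    rw [h3]
    gcongr
  have hmono : eLpNorm (E.indicator fun _ => (1 / 2 : ℝ)) (ENNReal.ofReal p) volume ≤
      eLpNorm (fourierMeasure (combMeasure q δ)) (ENNReal.ofReal p) volume := by
    refine eLpNorm_mono fun ξ => ?_
    by_cases hξ : ξ ∈ E
    · rw [Set.indicator_of_mem hξ]
      obtain ⟨m, hm, hξm⟩ := Set.mem_iUnion₂.1 hξ
      have hmK : (m : ℝ) + 1 ≤ K := by exact_mod_cast Finset.mem_range.1 hm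
      have h4 : ξ ≤ (m + 1) * q := by linarith [hξm.2]
      have h5 : ξ ≤ (16 * (δ * q))⁻¹ * q :=
        h4.trans (mul_le_mul_of_nonneg_right (hmK.trans hKle) (by positivity))
      have h6 : δ * ξ ≤ 1 / 16 := by
        calc δ * ξ ≤ δ * ((16 * (δ * q))⁻¹ * q) := by gcongr
          _ = 1 / 16 := by field_simp
      rw [Real.norm_of_nonneg (by norm_num)]
      exact half_le_norm_fourierMeasure_combMeasure hq hδ m hξm.1 hξm.2 h6
    · rw [Set.indicator_of_notMem hξ]
      simp
  refine le_trans ?_ hmono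
  rw [eLpNorm_indicator_const hEm (by simpa using hp) ENNReal.ofReal_ne_top,
    ENNReal.toReal_ofReal hp.le, ENNReal.ofReal_mul (by norm_num),
    Real.enorm_of_nonneg (by norm_num),
    ← ENNReal.ofReal_rpow_of_nonneg (by positivity) (by positivity)]
  gcongr

/-! ### Consequences of the restriction inequality -/

/-- The restriction inequality bounds the Fourier transform of every measure dominated
by `μ`. -/
theorem RestrictionInequality.eLpNorm_fourierMeasure_le {μ : Measure ℝ} [IsFiniteMeasure μ]
    {p : ℝ} (h : RestrictionInequality μ p) :
    ∃ C : ℝ, 0 < C ∧ ∀ ν : Measure ℝ, ν ≤ μ →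
      eLpNorm (fourierMeasure ν) (ENNReal.ofReal p) volume ≤
        ENNReal.ofReal C * ν Set.univ ^ (1 / 2 : ℝ) := by
  obtain ⟨C, hC, H⟩ := h
  refine ⟨C, hC, fun ν hν => ?_⟩
  have : IsFiniteMeasure ν := isFiniteMeasure_of_le μ hν
  have hac : ν ≪ μ := Measure.absolutelyContinuous_of_le hν
  have hle := Measure.rnDeriv_le_one_of_le hν
  -- The test function is the density of `ν`; being at most `1`, its square is bounded by itself, so
  -- its squared norm is at most the mass of `ν`.
  set f : ℝ → ℂ := fun x => ((ν.rnDeriv μ x).toReal : ℂ) with hf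
  have hfm : Measurable f :=
    Complex.measurable_ofReal.comp (Measure.measurable_rnDeriv ν μ).ennreal_toReal
  have henorm : ∀ᵐ x ∂μ, ‖f x‖ₑ = ν.rnDeriv μ x := by
    filter_upwards [hle] with x hx
    have hx' : ν.rnDeriv μ x ≠ ⊤ := ne_top_of_le_ne_top ENNReal.one_ne_top hx
    rw [hf]
    simp only
    rw [← ofReal_norm, Complex.norm_real, Real.norm_of_nonneg ENNReal.toReal_nonneg,
      ENNReal.ofReal_toReal hx']
  have hnorm : eLpNorm f 2 μ ≤ ν Set.univ ^ (1 / 2 : ℝ) := by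
    rw [eLpNorm_eq_lintegral_rpow_enorm_toReal (by norm_num) (by norm_num),
      ← Measure.lintegral_rnDeriv hac, ENNReal.toReal_ofNat]
    refine ENNReal.rpow_le_rpow (lintegral_mono_ae ?_) (by norm_num)
    filter_upwards [hle, henorm] with x hx hx2
    rw [hx2]
    calc ν.rnDeriv μ x ^ (2 : ℝ) = ν.rnDeriv μ x * ν.rnDeriv μ x := by
          rw [ENNReal.rpow_two, sq]
      _ ≤ 1 * ν.rnDeriv μ x := by gcongr; exact hx
      _ = ν.rnDeriv μ x := one_mul _
  have hfour : fourierMul μ f = fourierMeasure ν := by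
    ext ξ
    rw [fourierMul_eq, fourierMeasure, fourierMul_eq, ← integral_rnDeriv_smul hac]
    refine integral_congr_ae (Filter.Eventually.of_forall fun x => ?_)
    simp only [hf, Complex.real_smul, mul_one]
    ring
  have hmem : MemLp f 2 μ := by
    refine ⟨hfm.aestronglyMeasurable, hnorm.trans_lt ?_⟩
    exact ENNReal.rpow_lt_top_of_nonneg (by norm_num) (measure_ne_top _ _)
  rw [← hfour]
  exact (H f hmem).trans (by gcongr)

theorem fourierMeasure_smul {c : ℝ} (hc : 0 ≤ c) (ν : Measure ℝ) :
    fourierMeasure (ENNReal.ofReal c • ν) = c • fourierMeasure ν := by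
  ext ξ
  rw [Pi.smul_apply, fourierMeasure_eq, fourierMeasure_eq, integral_smul_measure,
    ENNReal.toReal_ofReal hc]

/-! ### Mixtures of measures -/

/-- The mixture `∑ pₙ νₙ`. -/
def mixture (p : ℕ → ℝ) (ν : ℕ → Measure ℝ) : Measure ℝ :=
  Measure.sum fun n => ENNReal.ofReal (p n) • ν n

theorem smul_le_mixture (p : ℕ → ℝ) (ν : ℕ → Measure ℝ) (n : ℕ) :
    ENNReal.ofReal (p n) • ν n ≤ mixture p ν :=
  Measure.le_sum (fun n => ENNReal.ofReal (p n) • ν n) n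

theorem isProbabilityMeasure_mixture {p : ℕ → ℝ} {ν : ℕ → Measure ℝ} (hp0 : ∀ n, 0 ≤ p n)
    (hp : HasSum p 1) (hν : ∀ n, IsProbabilityMeasure (ν n)) :
    IsProbabilityMeasure (mixture p ν) := by
  refine ⟨?_⟩
  rw [mixture, Measure.sum_apply _ MeasurableSet.univ]
  simp only [Measure.smul_apply, measure_univ, smul_eq_mul, mul_one]
  rw [← ENNReal.ofReal_tsum_of_nonneg hp0 hp.summable, hp.tsum_eq, ENNReal.ofReal_one]

theorem ballCondition_mixture {p s : ℕ → ℝ} {ν : ℕ → Measure ℝ} {a : ℝ}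
    (hs0 : ∀ n, 0 ≤ s n) (hs : Summable s)
    (h : ∀ n x r, 0 < r →
      ENNReal.ofReal (p n) * ν n (Metric.ball x r) ≤ ENNReal.ofReal (s n * r ^ a)) :
    BallCondition (mixture p ν) a := by
  have hpos : 0 ≤ ∑' n, s n := tsum_nonneg hs0
  refine ⟨∑' n, s n + 1, by linarith, fun x r hr => ?_⟩
  have hra : 0 ≤ r ^ a := by positivity
  rw [mixture, Measure.sum_apply _ measurableSet_ball]
  calc ∑' n, (ENNReal.ofReal (p n) • ν n) (Metric.ball x r)
      ≤ ∑' n, ENNReal.ofReal (s n * r ^ a) := ENNReal.tsum_le_tsum fun n => h n x r hr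
    _ = ENNReal.ofReal ((∑' n, s n) * r ^ a) := by
        rw [← tsum_mul_right, ENNReal.ofReal_tsum_of_nonneg
          (fun n => mul_nonneg (hs0 n) hra) (hs.mul_right _)]
    _ ≤ _ := ENNReal.ofReal_le_ofReal (by gcongr; linarith)

theorem fourierDecay_mixture {p s : ℕ → ℝ} {ν : ℕ → Measure ℝ} {b : ℝ}
    [IsFiniteMeasure (mixture p ν)] (hp0 : ∀ n, 0 ≤ p n)
    (hs0 : ∀ n, 0 ≤ s n) (hs : Summable s)
    (h : ∀ n ξ, p n * ‖fourierMeasure (ν n) ξ‖ ≤ s n * (1 + |ξ|) ^ (-b / 2)) :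
    FourierDecay (mixture p ν) b := by
  have hpos : 0 ≤ ∑' n, s n := tsum_nonneg hs0
  refine ⟨∑' n, s n + 1, by linarith, fun ξ => ?_⟩
  have hint : Integrable (fun x : ℝ => Complex.exp (-(2 * Real.pi * ξ) * Complex.I * x))
      (mixture p ν) :=
    Integrable.of_bound (Continuous.aestronglyMeasurable (by fun_prop)) 1
      (Filter.Eventually.of_forall fun x => (norm_exp_character ξ x).le)
  have hsum : HasSum (fun n => fourierMeasure (ENNReal.ofReal (p n) • ν n) ξ)
      (fourierMeasure (mixture p ν) ξ) := by
    simp only [fourierMeasure_eq]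
    exact hasSum_integral_measure hint
  have hle : ‖fourierMeasure (mixture p ν) ξ‖ ≤ (∑' n, s n) * (1 + |ξ|) ^ (-b / 2) := by
    refine hsum.norm_le_of_bounded (hs.hasSum.mul_right _) fun n => ?_
    rw [fourierMeasure_smul (hp0 n), Pi.smul_apply, norm_smul, Real.norm_of_nonneg (hp0 n)]
    exact h n ξ
  refine hle.trans ?_
  gcongr
  linarith

/-- The restriction inequality for a mixture with a comb component bounds the weight of that
component. -/
theorem RestrictionInequality.sqrt_weight_mul_le {P : ℕ → ℝ} {q : ℕ → ℕ} {δ : ℕ → ℝ} {p : ℝ}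
    [IsFiniteMeasure (mixture P fun n => combMeasure (q n) (δ n))]
    (hP : ∀ n, 0 < P n) (hq : ∀ n, 0 < q n) (hδ : ∀ n, 0 < δ n) (hp : 0 < p)
    (h : RestrictionInequality (mixture P fun n => combMeasure (q n) (δ n)) p) :
    ∃ C : ℝ, 0 < C ∧ ∀ n, 16 * (δ n * q n) ≤ 1 →
      P n ^ (1 / 2 : ℝ) * (512 * (δ n * q n))⁻¹ ^ (1 / p) ≤ C := by
  obtain ⟨C, hC, H⟩ := h.eLpNorm_fourierMeasure_le
  refine ⟨2 * C, by positivity, fun n hn => ?_⟩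
  have := isProbabilityMeasure_combMeasure (hq n) (hδ n)
  have h1 := H _ (smul_le_mixture P (fun n => combMeasure (q n) (δ n)) n)
  have hPn := hP n
  rw [fourierMeasure_smul hPn.le, eLpNorm_const_smul, Measure.smul_apply, measure_univ,
    smul_eq_mul, mul_one, Real.enorm_of_nonneg hPn.le,
    ENNReal.ofReal_rpow_of_nonneg hPn.le (by norm_num), ← ENNReal.ofReal_mul hC.le] at h1
  have h2 := (mul_le_mul_right
    (le_eLpNorm_fourierMeasure_combMeasure (hq n) (hδ n) hp hn) _).trans h1
  rw [← ENNReal.ofReal_mul hPn.le, ENNReal.ofReal_le_ofReal_iff (by positivity)] at h2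
  have h3 : P n = P n ^ (1 / 2 : ℝ) * P n ^ (1 / 2 : ℝ) := by
    rw [← Real.rpow_add hPn]; norm_num
  have h4 : 0 < P n ^ (1 / 2 : ℝ) := by positivity
  -- The transform scales like `P` but the `L^2` bound like `P ^ (1/2)`; cancelling leaves `P ^
  -- (1/2)`.
  nth_rewrite 1 [h3] at h2
  refine le_of_mul_le_mul_left ?_ h4
  linarith

/-! ### The counterexample -/

theorem mainTheorem3 (a b : ℝ) (ha0 : 0 < a) (ha1 : a < 1) (hb0 : 0 < b) (hb1 : b < 1)
    (hab : b ≤ 2 * a) (p₀ : ℝ) (hp₀ : p₀ < pStar a b 1) :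
    ∃ μ : Measure ℝ, IsProbabilityMeasure μ ∧ BallCondition μ a ∧ FourierDecay μ b ∧
      ∃ p : ℝ, 1 ≤ p ∧ p₀ ≤ p ∧ ¬ RestrictionInequality μ p := by
  -- The maximum stays below `pStar a b 1`, which exceeds `1` because `a < 1`.
  set p := max p₀ 1 with hp
  have hp1 : 1 ≤ p := le_max_right _ _
  have hp0 : 0 < p := by linarith
  have hpstar : p < pStar a b 1 := by
    refine max_lt hp₀ ?_
    rw [pStar, lt_div_iff₀ hb0]
    linarith
  set s := b / 2 with hs
  set τ := 1 - a + s with hτ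
  set η := τ / p - s / 2 with hη
  have hη0 : 0 < η := by
    rw [pStar, lt_div_iff₀ hb0] at hpstar
    rw [hη, sub_pos, lt_div_iff₀ hp0]
    have : s / 2 * p = p * b / 4 := by rw [hs]; ring
    linarith
  have hτ0 : 0 < τ := by linarith
  set t : ℕ → ℝ := fun n => (1 / 2) ^ n with ht
  have ht0 : ∀ n, 0 < t n := fun n => by positivity
  have ht1 : ∀ n, t n ≤ 1 := fun n => pow_le_one₀ (by norm_num) (by norm_num)
  have htsum : HasSum t 2 := hasSum_geometric_two
  set δ : ℕ → ℝ := fun n => t n ^ (1 / η) with hδ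
  have hδ0 : ∀ n, 0 < δ n := fun n => Real.rpow_pos_of_pos (ht0 n) _
  have hδ1 : ∀ n, δ n ≤ 1 := fun n => Real.rpow_le_one (ht0 n).le (ht1 n) (by positivity)
  set q : ℕ → ℕ := fun n => ⌈δ n ^ (s - a)⌉₊ with hq
  -- This is where `b ≤ 2 * a` enters: it makes `s - a ≤ 0`, so rounding up at most doubles.
  have hq1 : ∀ n, 1 ≤ δ n ^ (s - a) := fun n =>
    Real.one_le_rpow_of_pos_of_le_one_of_nonpos (hδ0 n) (hδ1 n) (by linarith)
  have hqge : ∀ n, δ n ^ (s - a) ≤ q n := fun n => Nat.le_ceil _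
  have hq0 : ∀ n, 0 < q n := fun n => Nat.ceil_pos.2 (by linarith [hq1 n])
  have hqle : ∀ n, (q n : ℝ) ≤ 2 * δ n ^ (s - a) := fun n => by
    have := Nat.ceil_lt_add_one (zero_le_one.trans (hq1 n))
    linarith [hq1 n]
  have hδq : ∀ n, δ n * q n ≤ 2 * δ n ^ τ := fun n => by
    calc δ n * q n ≤ δ n * (2 * δ n ^ (s - a)) :=
          mul_le_mul_of_nonneg_left (hqle n) (hδ0 n).le
      _ = 2 * (δ n ^ (1 : ℝ) * δ n ^ (s - a)) := by rw [Real.rpow_one]; ring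
      _ = 2 * δ n ^ τ := by
        rw [← Real.rpow_add (hδ0 n)]
        congr 2
        ring
  set w : ℕ → ℝ := fun n => δ n ^ s with hw
  have hw0 : ∀ n, 0 < w n := fun n => Real.rpow_pos_of_pos (hδ0 n) _
  have hw1 : ∀ n, w n ≤ 1 := fun n => Real.rpow_le_one (hδ0 n).le (hδ1 n) (by positivity)
  have hwq : ∀ n, w n / q n ≤ δ n ^ a := fun n => by
    rw [div_le_iff₀ (by exact_mod_cast hq0 n)]
    calc w n = δ n ^ a * δ n ^ (s - a) := by
          rw [← Real.rpow_add (hδ0 n), add_sub_cancel]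
      _ ≤ δ n ^ a * q n :=
          mul_le_mul_of_nonneg_left (hqge n) (Real.rpow_nonneg (hδ0 n).le _)
  have htw : ∀ n, t n * w n ≤ t n := fun n => mul_le_of_le_one_right (ht0 n).le (hw1 n)
  have htws : Summable fun n => t n * w n :=
    Summable.of_nonneg_of_le (fun n => (mul_pos (ht0 n) (hw0 n)).le) htw htsum.summable
  set Z := ∑' n, t n * w n with hZ
  have hZ0 : 0 < Z := htws.tsum_pos (fun n => (mul_pos (ht0 n) (hw0 n)).le) 0
    (mul_pos (ht0 0) (hw0 0))
  have hZ2 : Z ≤ 2 := by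
    rw [← htsum.tsum_eq]
    exact htws.tsum_le_tsum htw htsum.summable
  set P : ℕ → ℝ := fun n => Z⁻¹ * t n * w n with hP
  have hP0 : ∀ n, 0 < P n := fun n =>
    mul_pos (mul_pos (inv_pos.2 hZ0) (ht0 n)) (hw0 n)
  have hPsum : HasSum P 1 := by
    have h := htws.hasSum.mul_left Z⁻¹
    rw [← hZ, inv_mul_cancel₀ hZ0.ne'] at h
    simpa only [hP, mul_assoc] using h
  have hprob : IsProbabilityMeasure (mixture P fun n => combMeasure (q n) (δ n)) :=
    isProbabilityMeasure_mixture (fun n => (hP0 n).le) hPsum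
      fun n => isProbabilityMeasure_combMeasure (hq0 n) (hδ0 n)
  have hZt : ∀ n, 0 ≤ Z⁻¹ * t n := fun n => (mul_pos (inv_pos.2 hZ0) (ht0 n)).le
  refine ⟨mixture P fun n => combMeasure (q n) (δ n), hprob, ?_, ?_, p, hp1,
    le_max_left _ _, ?_⟩
  · refine ballCondition_mixture (s := fun n => Z⁻¹ * t n * 8)
      (fun n => mul_nonneg (hZt n) (by norm_num))
      ((htsum.summable.mul_left _).mul_right _) fun n x r hr => ?_
    have h := mul_combMeasure_ball_le (hq0 n) (hδ0 n) ha0 ha1 (hw0 n).le (hw1 n) (hwq n) x hr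
    rw [hP]
    simp only
    rw [ENNReal.ofReal_mul (hZt n), mul_assoc, mul_assoc (Z⁻¹ * t n), ENNReal.ofReal_mul (hZt n)]
    gcongr
  · refine fourierDecay_mixture (s := fun n => Z⁻¹ * t n * 2) (fun n => (hP0 n).le)
      (fun n => mul_nonneg (hZt n) (by norm_num))
      ((htsum.summable.mul_left _).mul_right _) fun n ξ => ?_
    have h := rpow_mul_norm_fourierMeasure_combMeasure_le (s := s) (hq0 n) (hδ0 n) (hδ1 n)
      (by positivity) (by linarith) ξ
    rw [neg_div, mul_assoc (Z⁻¹ * t n), mul_assoc (Z⁻¹ * t n)]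
    exact mul_le_mul_of_nonneg_left h (hZt n)
  · intro hR
    obtain ⟨C, hC, H⟩ := hR.sqrt_weight_mul_le hP0 hq0 hδ0 hp0
    -- The `2` comes from `Z ≤ 2`, and `1024 = 2 * 512` from the rounding of `q n`; the choice of `δ
    -- n` turns `δ n ^ (-η)` into `(t n)⁻¹`.
    have hlow : ∀ n, (t n / 2) ^ (1 / 2 : ℝ) * (1024⁻¹ ^ (1 / p) * (t n)⁻¹) ≤
        P n ^ (1 / 2 : ℝ) * (512 * (δ n * q n))⁻¹ ^ (1 / p) := fun n => by
      have hqn : (0 : ℝ) < q n := by exact_mod_cast hq0 n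
      have hδn := hδ0 n
      have htn := ht0 n
      have e1 : δ n ^ (s / 2) * (δ n ^ τ)⁻¹ ^ (1 / p) = (t n)⁻¹ := by
        rw [← Real.rpow_neg hδn.le, ← Real.rpow_mul hδn.le, ← Real.rpow_add hδn, hδ]
        simp only
        rw [← Real.rpow_mul htn.le, ← Real.rpow_neg_one]
        congr 1
        have : s / 2 + -τ * (1 / p) = -η := by rw [hη]; ring
        rw [this]
        field_simp
      have e2 : w n ^ (1 / 2 : ℝ) = δ n ^ (s / 2) := by
        rw [hw]
        simp only
        rw [← Real.rpow_mul hδn.le]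
        congr 1
        ring
      have i1 : t n / 2 * w n ≤ P n := by
        have : (2 : ℝ)⁻¹ ≤ Z⁻¹ := inv_anti₀ hZ0 hZ2
        have := mul_le_mul_of_nonneg_right this (mul_pos htn (hw0 n)).le
        rw [hP]
        simp only
        linarith
      have i2 : 1024⁻¹ * (δ n ^ τ)⁻¹ ≤ (512 * (δ n * q n))⁻¹ := by
        rw [← mul_inv]
        exact inv_anti₀ (by positivity) (by linarith [hδq n])
      have hwn := (hw0 n).le
      calc (t n / 2) ^ (1 / 2 : ℝ) * (1024⁻¹ ^ (1 / p) * (t n)⁻¹)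
          = (t n / 2 * w n) ^ (1 / 2 : ℝ) * (1024⁻¹ * (δ n ^ τ)⁻¹) ^ (1 / p) := by
            rw [← e1, Real.mul_rpow (by positivity) hwn,
              Real.mul_rpow (by positivity) (by positivity), e2]
            ring
        _ ≤ _ := by gcongr
    have htend : Filter.Tendsto t Filter.atTop (nhds 0) :=
      tendsto_pow_atTop_nhds_zero_of_lt_one (by norm_num) (by norm_num)
    -- Since `δ n * q n ≤ 2 * δ n ^ τ`, this eventually secures `16 * (δ n * q n) ≤ 1`.
    have hδtend : Filter.Tendsto (fun n => 32 * δ n ^ τ) Filter.atTop (nhds 0) := by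
      have h1 := (htend.rpow_const (p := 1 / η) (Or.inr (by positivity))).rpow_const
        (p := τ) (Or.inr hτ0.le)
      rw [Real.zero_rpow (by positivity), Real.zero_rpow hτ0.ne'] at h1
      simpa only [mul_zero] using h1.const_mul 32
    set c : ℝ := (1 / 2) ^ (1 / 2 : ℝ) * 1024⁻¹ ^ (1 / p) with hc
    have hc0 : 0 < c := by positivity
    have hev : ∀ᶠ n in Filter.atTop, c ≤ C * t n ^ (1 / 2 : ℝ) := by
      filter_upwards [hδtend.eventually_le_const zero_lt_one] with n hn
      have h1 := (hlow n).trans (H n (by linarith [hδq n]))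
      have htn := ht0 n
      have hr : 0 < t n ^ (1 / 2 : ℝ) := by positivity
      have h2 : t n = t n ^ (1 / 2 : ℝ) * t n ^ (1 / 2 : ℝ) := by
        rw [← Real.rpow_add htn]; norm_num
      have h3 : (t n / 2) ^ (1 / 2 : ℝ) * (1024⁻¹ ^ (1 / p) * (t n)⁻¹) =
          c / t n ^ (1 / 2 : ℝ) := by
        rw [div_eq_mul_one_div (t n), Real.mul_rpow htn.le (by norm_num), hc]
        nth_rewrite 2 [h2]
        field_simp
      rwa [h3, div_le_iff₀ hr] at h1
    have hlim : Filter.Tendsto (fun n => C * t n ^ (1 / 2 : ℝ)) Filter.atTop (nhds 0) := by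
      have h1 := (htend.rpow_const (p := (1 / 2 : ℝ)) (Or.inr (by norm_num))).const_mul C
      rwa [Real.zero_rpow (by norm_num), mul_zero] at h1
    exact hc0.not_ge (ge_of_tendsto hlim hev)

end
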